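/- Let $(X,d)$ be a complete and separable metric space, $p\in(1,+\infty)$ and $T>0$. Let $\mathrm C([0,T];X)$ be the space of continuous curves with the supremum distance $d_\infty$. For a complete separable metric space $(Y,\rho)$ let $\mathcal P_p(Y)$ be the set of Borel probability measures $\mu$ on $Y$ with $\int \rho(y,y_0)^p\,\mathrm d\mu(y)<+\infty$ for some (hence any) $y_0\in Y$, endowed with the $p$-Wasserstein distance $W_p(\mu,\nu)=\bigl(\inf_{\pi}\int \rho(y,y')^p\,\mathrm d\pi(y,y')\bigr)^{1/p}$, the infimum being over all couplings $\pi$ of $\mu$ and $\nu$; let $\mathrm C([0,T];\mathcal P_p(X))$ carry the topology of uniform convergence. Write $\mathsf e_t(\gamma)=\gamma(t)$, and let $\mathrm{AC}^p([0,T];X)$ be the set of curves $\gamma$ for which there is $m\in L^p(0,T)$ with $d(\gamma_s,\gamma_t)\le\int_s^t m(r)\,\mathrm dr$ for all $0\le s\le t\le T$. Define the $p$-action $\mathcal A_p:\mathrm C([0,T];X)\to[0,+\infty]$ by $$\mathcal A_p(\gamma)=\int_0^T|\dot\gamma_t|_d^p\,\mathrm dt\ \text{ if }\gamma\in\mathrm{AC}^p([0,T];X),\qquad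 \mathcal A_p(\gamma)=+\infty\ \text{ otherwise},$$ where $|\dot\gamma_t|_d=\lim_{s\to t}d(\gamma_s,\gamma_t)/|s-t|$ is the metric derivative (which exists for a.e. $t$ if $\gamma\in \mathrm{AC}^p([0,T];X)$). Let $\mathcal K\subset\mathcal P_p(\mathrm C([0,T];X))$ be such that 1. $\sup_{\boldsymbol\eta\in\mathcal K}\int\mathcal A_p\,\mathrm d\boldsymbol\eta<+\infty$; 2. $\sup\{d(x,x_0): x\in\operatorname{supp}((\mathsf e_0)_\sharp\boldsymbol\eta),\ \boldsymbol\eta\in\mathcal K\}<+\infty$ for some (hence for any) $x_0\in X$; 3. the set of curves $\{(t\mapsto(\mathsf e_t)_\sharp\boldsymbol\eta):\boldsymbol\eta\in\mathcal K\}$ is relatively compact in $\mathrm C([0,T];\mathcal P_p(X))$. Then $\mathcal K$ is relatively compact in $\mathcal P_p(\mathrm C([0,T];X))$. -/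

import Mathlib

open MeasureTheory ProbabilityTheory Filter Topology Set
open scoped ENNReal

noncomputable section

/-- `𝒫_p(X)`: the Borel probability measures on `X` with finite `p`-moment, i.e.
`∫ d(x, x₀)^p dμ(x) < ∞` for some (equivalently, any) `x₀`. It carries the topology of the
`p`-Wasserstein distance, defined below (not the narrow topology). -/
structure WassersteinSpace (p : ℝ) (X : Type*) [MetricSpace X] [MeasurableSpace X] where
  /-- The underlying probability measure. -/
  toMeasure : Measure X
  /-- It has total mass one. -/
  isProb : IsProbabilityMeasure toMeasure
  /-- It has finite `p`-moment. -/
  moment : ∃ x₀ : X, ∫⁻ x, edist x x₀ ^ p ∂toMeasure < ∞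

attribute [instance] WassersteinSpace.isProb

/-- `Γ(μ, ν)`: the couplings of `μ` and `ν`. -/
def couplings {X : Type*} [MeasurableSpace X] (μ ν : Measure X) : Set (Measure (X × X)) :=
  {π | π.fst = μ ∧ π.snd = ν}

lemma swap_mem_couplings {X : Type*} [MeasurableSpace X] {μ ν : Measure X} {π : Measure (X × X)} (hπ : π ∈ couplings μ ν) :
    π.map Prod.swap ∈ couplings ν μ := by
  refine ⟨?_, ?_⟩
  · rw [Measure.fst_map_swap]; exact hπ.2
  · rw [Measure.snd_map_swap]; exact hπ.1

/-- The `p`-Wasserstein distance `W_p(μ, ν) = (inf_{π ∈ Γ(μ, ν)} ∫ d(x, y)^p dπ(x, y))^{1/p}`. -/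
def wassersteinDist {X : Type*} [MetricSpace X] [MeasurableSpace X] (p : ℝ) (μ ν : Measure X) :
    ℝ≥0∞ :=
  (⨅ π ∈ couplings μ ν, ∫⁻ z, edist z.1 z.2 ^ p ∂π) ^ (1 / p)

section Wasserstein

variable {X : Type*} [MetricSpace X] [MeasurableSpace X]

lemma wassersteinDist_le {p : ℝ} (hp : 1 ≤ p) {μ ν : Measure X} {π : Measure (X × X)}
    (hπ : π ∈ couplings μ ν) :
    wassersteinDist p μ ν ≤ (∫⁻ z, edist z.1 z.2 ^ p ∂π) ^ (1 / p) :=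
  ENNReal.rpow_le_rpow (iInf₂_le π hπ) (by positivity)

lemma exists_coupling_of_wassersteinDist_lt {p : ℝ} (hp : 1 ≤ p) {μ ν : Measure X} {c : ℝ≥0∞}
    (h : wassersteinDist p μ ν < c) :
    ∃ π ∈ couplings μ ν, (∫⁻ z, edist z.1 z.2 ^ p ∂π) ^ (1 / p) < c := by
  have hp0 : 0 < p := by linarith
  have h' : (⨅ π ∈ couplings μ ν, ∫⁻ z, edist z.1 z.2 ^ p ∂π) < c ^ p := by
    rw [wassersteinDist, one_div] at h
    exact (ENNReal.rpow_inv_lt_iff hp0).1 h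
  simp only [iInf_lt_iff] at h'
  obtain ⟨π, hπ, hlt⟩ := h'
  refine ⟨π, hπ, ?_⟩
  rw [one_div]
  exact (ENNReal.rpow_inv_lt_iff hp0).2 hlt

variable [SecondCountableTopology X] [BorelSpace X]

lemma wassersteinDist_self {p : ℝ} (hp : 1 ≤ p) (μ : Measure X) : wassersteinDist p μ μ = 0 := by
  have hp0 : 0 < p := by linarith
  have hm : Measurable fun x : X => (x, x) := by fun_prop
  have hπ : μ.map (fun x => (x, x)) ∈ couplings μ μ := by
    constructor
    · rw [Measure.fst, Measure.map_map measurable_fst hm]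
      exact Measure.map_id
    · rw [Measure.snd, Measure.map_map measurable_snd hm]
      exact Measure.map_id
  refine le_antisymm ((wassersteinDist_le hp hπ).trans ?_) zero_le
  rw [lintegral_map (by fun_prop) hm]
  simp [hp0]

lemma wassersteinDist_comm_le {p : ℝ} (μ ν : Measure X) :
    (⨅ π ∈ couplings μ ν, ∫⁻ z, edist z.1 z.2 ^ p ∂π)
      ≤ ⨅ π ∈ couplings ν μ, ∫⁻ z, edist z.1 z.2 ^ p ∂π := by
  refine le_iInf₂ fun π hπ => (iInf₂_le _ (swap_mem_couplings hπ)).trans ?_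
  rw [lintegral_map (by fun_prop) measurable_swap]
  simp [edist_comm]

lemma wassersteinDist_comm (p : ℝ) (μ ν : Measure X) :
    wassersteinDist p μ ν = wassersteinDist p ν μ := by
  rw [wassersteinDist, wassersteinDist,
    le_antisymm (wassersteinDist_comm_le μ ν) (wassersteinDist_comm_le ν μ)]

variable [CompleteSpace X]

lemma exists_gluing {μ ν ρ : Measure X} [IsProbabilityMeasure ν] {π₁ π₂ : Measure (X × X)}
    (h₁ : π₁ ∈ couplings μ ν) (h₂ : π₂ ∈ couplings ν ρ) :
    ∃ ω : Measure (X × X × X),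
      ω.map (fun z => (z.2.1, z.1)) = π₁ ∧ ω.map (fun z => (z.1, z.2.2)) = π₂ := by
  have : Nonempty X := nonempty_of_isProbabilityMeasure ν
  set π₁' : Measure (X × X) := π₁.map Prod.swap with hπ₁'
  have h₁' : π₁' ∈ couplings ν μ := swap_mem_couplings h₁
  have : IsProbabilityMeasure π₁' := ⟨by rw [← Measure.fst_univ, h₁'.1]; exact measure_univ⟩
  have : IsProbabilityMeasure π₂ := ⟨by rw [← Measure.fst_univ, h₂.1]; exact measure_univ⟩
  refine ⟨ν ⊗ₘ (π₁'.condKernel ×ₖ π₂.condKernel), ?_, ?_⟩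
  · have e : (ν ⊗ₘ (π₁'.condKernel ×ₖ π₂.condKernel)).map (fun z => (z.1, z.2.1)) = π₁' := by
      have := Measure.compProd_map (μ := ν) (κ := π₁'.condKernel ×ₖ π₂.condKernel)
        (f := Prod.fst) measurable_fst
      rw [← Kernel.fst_eq, Kernel.fst_prod, ← h₁'.1, π₁'.disintegrate π₁'.condKernel] at this
      rw [h₁'.1] at this
      exact this.symm
    have e2 : (ν ⊗ₘ (π₁'.condKernel ×ₖ π₂.condKernel)).map (fun z => (z.2.1, z.1))
        = π₁'.map Prod.swap := by
      conv_rhs => rw [← e]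
      rw [Measure.map_map measurable_swap (by fun_prop)]
      rfl
    rw [e2, hπ₁', Measure.map_map measurable_swap measurable_swap]
    simp
  · have := Measure.compProd_map (μ := ν) (κ := π₁'.condKernel ×ₖ π₂.condKernel)
      (f := Prod.snd) measurable_snd
    rw [← Kernel.snd_eq, Kernel.snd_prod, ← h₂.1, π₂.disintegrate π₂.condKernel] at this
    rw [h₂.1] at this
    exact this.symm

lemma wassersteinDist_triangle {p : ℝ} (hp : 1 ≤ p) (μ ν ρ : Measure X) [IsProbabilityMeasure ν] :
    wassersteinDist p μ ρ ≤ wassersteinDist p μ ν + wassersteinDist p ν ρ := by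
  have hp0 : 0 < p := by linarith
  refine ENNReal.le_of_forall_pos_le_add fun ε hε hfin => ?_
  have hε' : (ε : ℝ≥0∞) / 2 ≠ 0 := by simp [hε.ne']
  obtain ⟨hf₁, hf₂⟩ := ENNReal.add_lt_top.1 hfin
  obtain ⟨π₁, hπ₁, hlt₁⟩ := exists_coupling_of_wassersteinDist_lt hp
    (ENNReal.lt_add_right hf₁.ne hε')
  obtain ⟨π₂, hπ₂, hlt₂⟩ := exists_coupling_of_wassersteinDist_lt hp
    (ENNReal.lt_add_right hf₂.ne hε')
  obtain ⟨ω, hω₁, hω₂⟩ := exists_gluing hπ₁ hπ₂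
  have hω : ω.map (fun z => (z.2.1, z.2.2)) ∈ couplings μ ρ := by
    constructor
    · rw [← hπ₁.1, ← hω₁, Measure.fst, Measure.fst, Measure.map_map (by fun_prop) (by fun_prop),
        Measure.map_map (by fun_prop) (by fun_prop)]
      rfl
    · rw [← hπ₂.2, ← hω₂, Measure.snd, Measure.snd, Measure.map_map (by fun_prop) (by fun_prop),
        Measure.map_map (by fun_prop) (by fun_prop)]
      rfl
  refine (wassersteinDist_le hp hω).trans ?_
  rw [← hω₁, lintegral_map (by fun_prop) (by fun_prop)] at hlt₁
  rw [← hω₂, lintegral_map (by fun_prop) (by fun_prop)] at hlt₂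
  rw [lintegral_map (by fun_prop) (by fun_prop)]
  calc (∫⁻ z : X × X × X, edist z.2.1 z.2.2 ^ p ∂ω) ^ (1 / p)
      ≤ (∫⁻ z : X × X × X,
          ((fun z : X × X × X => edist z.2.1 z.1) + fun z : X × X × X => edist z.1 z.2.2) z ^ p
          ∂ω) ^ (1 / p) := by
        gcongr with z
        exact edist_triangle _ _ _
    _ ≤ (∫⁻ z : X × X × X, edist z.2.1 z.1 ^ p ∂ω) ^ (1 / p)
        + (∫⁻ z : X × X × X, edist z.1 z.2.2 ^ p ∂ω) ^ (1 / p) :=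
        ENNReal.lintegral_Lp_add_le (by fun_prop) (by fun_prop) hp
    _ ≤ (wassersteinDist p μ ν + ε / 2) + (wassersteinDist p ν ρ + ε / 2) :=
        add_le_add hlt₁.le hlt₂.le
    _ = wassersteinDist p μ ν + wassersteinDist p ν ρ + ε := by
        rw [add_add_add_comm, ENNReal.add_halves]

/-- `𝒫_p(X)` with the distance `W_p`; all topological notions on `𝒫_p(X)` refer to it. -/
instance WassersteinSpace.instPseudoEMetricSpace {p : ℝ} [hp : Fact (1 ≤ p)] :
    PseudoEMetricSpace (WassersteinSpace p X) where
  edist μ ν := wassersteinDist p μ.toMeasure ν.toMeasure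
  edist_self μ := wassersteinDist_self hp.out μ.toMeasure
  edist_comm μ ν := wassersteinDist_comm p μ.toMeasure ν.toMeasure
  edist_triangle μ ν ρ := wassersteinDist_triangle hp.out μ.toMeasure ν.toMeasure ρ.toMeasure

end Wasserstein

section Paths

variable {X : Type*} [MetricSpace X] {T : ℝ}

/-- `C([0,T]; X)`, whose metric is the supremum distance, carries its Borel `σ`-algebra. -/
instance instMeasurableSpacePath : MeasurableSpace C(Icc (0 : ℝ) T, X) := borel _

instance instBorelSpacePath : BorelSpace C(Icc (0 : ℝ) T, X) := ⟨rfl⟩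

/-- `γ ∈ AC^p([0,T]; X)`: there is `m ∈ L^p(0,T)` with `d(γ_s, γ_t) ≤ ∫_s^t m(r) dr` for all
`0 ≤ s ≤ t ≤ T`. -/
def IsACp (p : ℝ) (γ : C(Icc (0 : ℝ) T, X)) : Prop :=
  ∃ m : ℝ → ℝ, MemLp m (ENNReal.ofReal p) (volume.restrict (Icc 0 T)) ∧
    ∀ s t : Icc (0 : ℝ) T, s ≤ t → dist (γ s) (γ t) ≤ ∫ r in (s : ℝ)..(t : ℝ), m r

/-- The metric derivative `|γ̇_t| = lim_{s → t} d(γ_s, γ_t) / |s - t|`. The limit exists for almost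
every `t` if `γ` is absolutely continuous; the upper limit extends the definition to every `t`. -/
def metricDerivative (γ : C(Icc (0 : ℝ) T, X)) (t : Icc (0 : ℝ) T) : ℝ≥0∞ :=
  limsup (fun s => edist (γ s) (γ t) / edist s t) (𝓝[≠] t)

open Classical in
/-- The `p`-action `𝒜_p(γ) = ∫_0^T |γ̇_t|^p dt` if `γ ∈ AC^p([0,T]; X)`, and `+∞` otherwise.
The measure `volume.comap Subtype.val` is the Lebesgue measure on `[0,T]`. -/
def pAction (p : ℝ) (γ : C(Icc (0 : ℝ) T, X)) : ℝ≥0∞ :=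
  if IsACp p γ then ∫⁻ t, metricDerivative γ t ^ p ∂(volume.comap Subtype.val) else ∞

lemma edist_evalPath_le (γ γ' : C(Icc (0 : ℝ) T, X)) (t : Icc (0 : ℝ) T) :
    edist (γ t) (γ' t) ≤ edist γ γ' := by
  rw [edist_dist, edist_dist]
  exact ENNReal.ofReal_le_ofReal (ContinuousMap.dist_apply_le_dist t)

variable [MeasurableSpace X] [BorelSpace X]

lemma measurable_evalPath (t : Icc (0 : ℝ) T) :
    Measurable fun γ : C(Icc (0 : ℝ) T, X) => γ t :=
  (ContinuousEvalConst.continuous_eval_const t).measurable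

/-- The marginal `(e_t)_♯ η ∈ 𝒫_p(X)` of `η ∈ 𝒫_p(C([0,T]; X))` at time `t`, where
`e_t(γ) = γ(t)`. -/
def marginal {p : ℝ} [hp : Fact (1 ≤ p)] (η : WassersteinSpace p C(Icc (0 : ℝ) T, X))
    (t : Icc (0 : ℝ) T) : WassersteinSpace p X where
  toMeasure := η.toMeasure.map fun γ => γ t
  isProb := Measure.isProbabilityMeasure_map (measurable_evalPath t).aemeasurable
  moment := by
    have hp0 : 0 ≤ p := by linarith [hp.out]
    obtain ⟨γ₀, hγ₀⟩ := η.moment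
    refine ⟨γ₀ t, ?_⟩
    have hm : Measurable fun x : X => edist x (γ₀ t) ^ p :=
      ((continuous_id.edist continuous_const).measurable).pow_const p
    rw [lintegral_map hm (measurable_evalPath t)]
    refine lt_of_le_of_lt (lintegral_mono fun γ => ?_) hγ₀
    exact ENNReal.rpow_le_rpow (edist_evalPath_le γ γ₀ t) hp0

variable [CompleteSpace X] [SecondCountableTopology X]

lemma continuous_marginal {p : ℝ} [hp : Fact (1 ≤ p)]
    (η : WassersteinSpace p C(Icc (0 : ℝ) T, X)) : Continuous (marginal η) := by
  have hp0 : 0 < p := by linarith [hp.out]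
  obtain ⟨γ₀, hγ₀⟩ := η.moment
  refine continuous_iff_continuousAt.2 fun t => tendsto_iff_edist_tendsto_0.2 ?_
  have hle : ∀ s, edist (marginal η s) (marginal η t)
      ≤ (∫⁻ γ, edist (γ s) (γ t) ^ p ∂η.toMeasure) ^ (1 / p) := by
    intro s
    have hm : Measurable fun γ : C(Icc (0 : ℝ) T, X) => (γ s, γ t) :=
      (measurable_evalPath s).prodMk (measurable_evalPath t)
    have hπ : η.toMeasure.map (fun γ => (γ s, γ t))
        ∈ couplings (marginal η s).toMeasure (marginal η t).toMeasure := by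
      constructor
      · rw [Measure.fst, Measure.map_map measurable_fst hm]; rfl
      · rw [Measure.snd, Measure.map_map measurable_snd hm]; rfl
    refine (wassersteinDist_le hp.out hπ).trans_eq ?_
    rw [lintegral_map (by fun_prop) hm]
  have hlim : Tendsto (fun s => ∫⁻ γ, edist (γ s) (γ t) ^ p ∂η.toMeasure) (𝓝 t) (𝓝 0) := by
    have hbase : ∫⁻ _ : C(Icc (0 : ℝ) T, X), (0 : ℝ≥0∞) ∂η.toMeasure = 0 := by simp
    rw [← hbase]
    obtain ⟨D, hD⟩ : ∃ D : ℝ, ∀ s, dist (γ₀ s) (γ₀ t) ≤ D := by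
      obtain ⟨D, hD⟩ := (isCompact_range γ₀.continuous).isBounded.subset_closedBall (γ₀ t)
      exact ⟨D, fun s => hD (mem_range_self s)⟩
    refine tendsto_lintegral_filter_of_dominated_convergence
      (fun γ => 2 ^ (p - 1) * ((2 * edist γ γ₀) ^ p + ENNReal.ofReal D ^ p)) ?_ ?_ ?_ ?_
    · refine Eventually.of_forall fun s => ?_
      exact ((measurable_evalPath s).edist (measurable_evalPath t)).pow_const p
    · refine Eventually.of_forall fun s => Eventually.of_forall fun γ => ?_
      have h1 : edist (γ s) (γ t) ≤ 2 * edist γ γ₀ + ENNReal.ofReal D := by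
        calc edist (γ s) (γ t)
            ≤ edist (γ s) (γ₀ s) + edist (γ₀ s) (γ₀ t) + edist (γ₀ t) (γ t) :=
              edist_triangle4 _ _ _ _
          _ ≤ edist γ γ₀ + ENNReal.ofReal D + edist γ γ₀ := by
              gcongr
              · exact edist_evalPath_le _ _ _
              · rw [edist_dist]; exact ENNReal.ofReal_le_ofReal (hD s)
              · rw [edist_comm]; exact edist_evalPath_le _ _ _
          _ = _ := by ring
      exact (ENNReal.rpow_le_rpow h1 hp0.le).trans
        (ENNReal.rpow_add_le_mul_rpow_add_rpow _ _ hp.out)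
    · have hmeas : Measurable fun γ : C(Icc (0 : ℝ) T, X) => (2 * edist γ γ₀) ^ p :=
        (((continuous_id.edist continuous_const).measurable).const_mul 2).pow_const p
      rw [lintegral_const_mul _ (hmeas.add_const _), lintegral_add_left hmeas]
      refine ENNReal.mul_ne_top (by finiteness) (ENNReal.add_ne_top.2 ⟨?_, ?_⟩)
      · have hmeas' : Measurable fun γ : C(Icc (0 : ℝ) T, X) => edist γ γ₀ ^ p :=
          ((continuous_id.edist continuous_const).measurable).pow_const p
        simp_rw [ENNReal.mul_rpow_of_nonneg _ _ hp0.le]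
        rw [lintegral_const_mul _ hmeas']
        exact ENNReal.mul_ne_top (by finiteness) hγ₀.ne
      · simp only [lintegral_const, measure_univ, mul_one]
        finiteness
    · refine Eventually.of_forall fun γ => ?_
      have h1 : Tendsto (fun s => edist (γ s) (γ t)) (𝓝 t) (𝓝 0) :=
        tendsto_iff_edist_tendsto_0.1 (γ.continuous.tendsto t)
      have h2 := h1.ennrpow_const p
      rwa [ENNReal.zero_rpow_of_pos hp0] at h2
  have hlim' := hlim.ennrpow_const (1 / p)
  rw [ENNReal.zero_rpow_of_pos (by positivity)] at hlim'
  exact tendsto_of_tendsto_of_tendsto_of_le_of_le tendsto_const_nhds hlim' (fun _ => zero_le) hle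

/-- The curve of marginals `t ↦ (e_t)_♯ η`, an element of `C([0,T]; 𝒫_p(X))`. The latter space
carries the topology of uniform convergence, which is the compact-open one. -/
def marginalCurve {p : ℝ} [Fact (1 ≤ p)] (η : WassersteinSpace p C(Icc (0 : ℝ) T, X)) :
    C(Icc (0 : ℝ) T, WassersteinSpace p X) :=
  ⟨marginal η, continuous_marginal η⟩

end Paths

end

/-! Since the Wasserstein space over a complete separable space is complete, it suffices to show
that `K` is totally bounded. In `𝒫_p(Y)` this means: for every `ε` a single finite set `F` satisfies
`‖d(·, F)‖_{L^p(μ)} ≤ ε` for all `μ` in the family. Necessity holds because `μ ↦ ‖d(·, F)‖_{L^p(μ)}`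
is `1`-Lipschitz for `W_p` (`TotallyBounded.exists_finset_lintegral_infEDist_le`). Sufficiency holds
because the nearest point map onto `F` sends each `μ`, at that cost, into the compact set of
probabilities on `F` (`totallyBounded_of_exists_finset_lintegral_infEDist_le`).

Compactness of the marginal curves yields this criterion on `X`, uniformly over all marginals at all
times. To lift it to path space, use `d(γ_s, γ_t) ≤ |s - t|^{1-1/p} 𝒜_p(γ)^{1/p}`
(`edist_le_edist_rpow_mul_pAction`): up to a small error, a curve is determined by its values on a
finite net `I` of times, and these values are close to `F`. There are finitely many maps `I → F`,
and one well-chosen curve for each gives the finite set in path space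
(`exists_finset_infEDist_path_le`). Integrating the `p`-th power leaves finitely many marginal
integrals and a small multiple of the action (`exists_finset_lintegral_infEDist_path_le`). -/

/-- A function whose increments are dominated by those of an absolutely continuous function is
absolutely continuous. -/
lemma AbsolutelyContinuousOnInterval.of_dist_le {X Y : Type*} [PseudoMetricSpace X]
    [PseudoMetricSpace Y] {f : ℝ → X} {g : ℝ → Y} {a b : ℝ}
    (hg : AbsolutelyContinuousOnInterval g a b)
    (h : ∀ x ∈ uIcc a b, ∀ y ∈ uIcc a b, dist (f x) (f y) ≤ dist (g x) (g y)) :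
    AbsolutelyContinuousOnInterval f a b := by
  rw [absolutelyContinuousOnInterval_iff] at hg ⊢
  intro ε hε
  obtain ⟨δ, hδ, H⟩ := hg ε hε
  refine ⟨δ, hδ, fun E hE hlt => (Finset.sum_le_sum fun i hi => ?_).trans_lt (H E hE hlt)⟩
  exact h _ (hE.1 i hi).1 _ (hE.1 i hi).2

/-! ### Hölder continuity of curves from their action -/

section HoelderEstimate

variable {X : Type*} [MetricSpace X] {T : ℝ}

/-- The distance to a fixed point along a curve of class `AC^p` is absolutely continuous. -/
lemma IsACp.absolutelyContinuousOnInterval_dist {p : ℝ} (hp : 1 ≤ p) (hT : 0 ≤ T)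
    {γ : C(Icc (0 : ℝ) T, X)} (h : IsACp p γ) (x : X) :
    AbsolutelyContinuousOnInterval (fun t => dist x (γ (projIcc 0 T hT t))) 0 T := by
  obtain ⟨m, hm, hγ⟩ := h
  have hm1 : IntervalIntegrable m volume 0 T := by
    rw [intervalIntegrable_iff_integrableOn_Icc_of_le hT]
    exact hm.integrable (by simpa using hp)
  refine (hm1.absolutelyContinuousOnInterval_intervalIntegral (c := 0) (by simp)).of_dist_le ?_
  rw [uIcc_of_le hT]
  have key : ∀ u ∈ Icc (0 : ℝ) T, ∀ v ∈ Icc (0 : ℝ) T, u ≤ v →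
      dist (dist x (γ (projIcc 0 T hT u))) (dist x (γ (projIcc 0 T hT v)))
        ≤ dist (∫ r in (0 : ℝ)..u, m r) (∫ r in (0 : ℝ)..v, m r) := by
    intro u hu v hv huv
    rw [projIcc_of_mem hT hu, projIcc_of_mem hT hv, dist_comm (∫ r in (0 : ℝ)..u, m r),
      Real.dist_eq (∫ r in (0 : ℝ)..v, m r), intervalIntegral.integral_interval_sub_left
        (hm1.mono_set (by rw [uIcc_of_le hT, uIcc_of_le hv.1]; exact Icc_subset_Icc_right hv.2))
        (hm1.mono_set (by rw [uIcc_of_le hT, uIcc_of_le hu.1]; exact Icc_subset_Icc_right hu.2))]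
    calc dist (dist x (γ ⟨u, hu⟩)) (dist x (γ ⟨v, hv⟩)) ≤ dist (γ ⟨u, hu⟩) (γ ⟨v, hv⟩) :=
          dist_dist_dist_le_right _ _ _
      _ ≤ ∫ r in u..v, m r := hγ ⟨u, hu⟩ ⟨v, hv⟩ huv
      _ ≤ _ := le_abs_self _
  intro u hu v hv
  rcases le_total u v with huv | huv
  · exact key u hu v hv huv
  · rw [dist_comm, dist_comm (∫ r in (0 : ℝ)..u, m r)]
    exact key v hv u hu huv

/-- The derivative of the distance to a fixed point is bounded by the metric derivative. -/
lemma enorm_deriv_dist_le_metricDerivative (hT : 0 < T) (γ : C(Icc (0 : ℝ) T, X)) (x : X)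
    (t : Icc (0 : ℝ) T)
    (hd : DifferentiableAt ℝ (fun t => dist x (γ (projIcc 0 T hT.le t))) t) :
    ‖deriv (fun t => dist x (γ (projIcc 0 T hT.le t))) t‖ₑ ≤ metricDerivative γ t := by
  -- No point of `[0,T]` is isolated, so the filter `𝓝[≠] t` is nontrivial and the limit of the
  -- difference quotients equals their upper limit. This also covers the endpoints.
  have : Nontrivial (Icc (0 : ℝ) T) :=
    ⟨⟨⟨0, le_rfl, hT.le⟩, ⟨T, hT.le, le_rfl⟩, by simpa [Subtype.ext_iff] using hT.ne⟩⟩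
  have : PreconnectedSpace (Icc (0 : ℝ) T) :=
    isPreconnected_iff_preconnectedSpace.1 isPreconnected_Icc
  have : (𝓝[≠] t).NeBot := inferInstance
  have h1 : Tendsto ((↑) : Icc (0 : ℝ) T → ℝ) (𝓝[≠] t) (𝓝[≠] (t : ℝ)) :=
    tendsto_nhdsWithin_of_tendsto_nhds_of_eventually_within _
      (continuous_subtype_val.continuousAt.tendsto.mono_left nhdsWithin_le_nhds)
      (eventually_nhdsWithin_of_forall fun s hs => by simpa [Subtype.ext_iff] using hs)
  have h2 := ((hasDerivAt_iff_tendsto_slope.1 hd.hasDerivAt).comp h1).enorm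
  rw [← h2.limsup_eq]
  refine limsup_le_limsup (eventually_nhdsWithin_of_forall fun s hs => ?_)
  have hs' : (s : ℝ) - t ≠ 0 := sub_ne_zero.2 (by simpa [Subtype.ext_iff] using hs)
  simp only [Function.comp_apply, slope_def_module, projIcc_val, smul_eq_mul, enorm_mul]
  rw [enorm_inv hs', mul_comm, ← div_eq_mul_inv, Subtype.edist_eq, edist_eq_enorm_sub (s : ℝ)]
  gcongr
  rw [← edist_eq_enorm_sub, edist_dist, edist_dist]
  exact ENNReal.ofReal_le_ofReal (dist_dist_dist_le_right _ _ _)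

/-- Curves with finite `p`-action are Hölder continuous of exponent `1 - 1/p`. -/
lemma edist_le_edist_rpow_mul_pAction {p : ℝ} (hp : 1 < p) (hT : 0 < T)
    (γ : C(Icc (0 : ℝ) T, X)) (s t : Icc (0 : ℝ) T) :
    edist (γ s) (γ t) ≤ edist s t ^ (1 - 1 / p) * pAction p γ ^ (1 / p) := by
  have hp0 : 0 < p := by linarith
  have hq : 0 < 1 - 1 / p := by
    rw [sub_pos, div_lt_one hp0]; exact hp
  wlog hst : s ≤ t generalizing s t
  · rw [edist_comm, edist_comm s]
    exact this t s (le_of_not_ge hst)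
  rcases eq_or_lt_of_le hst with rfl | hlt
  · simp
  by_cases hγ : IsACp p γ
  swap
  -- The case `s = t` had to be removed first: only a nonzero factor makes the product with infinite
  -- action infinite.
  · have h0 : edist s t ^ (1 - 1 / p) ≠ 0 := by
      simp [hlt.ne]
    rw [pAction, if_neg hγ, ENNReal.top_rpow_of_pos (by positivity), ENNReal.mul_top h0]
    exact le_top
  -- Real-valued surrogate for the curve: `f` vanishes at `s` and equals `d(γ_s, γ_t)` at `t`, so
  -- the fundamental theorem of calculus applies.
  set f : ℝ → ℝ := fun r => dist (γ s) (γ (projIcc 0 T hT.le r)) with hf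
  have hst' : (s : ℝ) ≤ t := hst
  have hsub : Ioc (s : ℝ) t ⊆ Icc 0 T := fun r hr => ⟨s.2.1.trans hr.1.le, hr.2.trans t.2.2⟩
  have hac := hγ.absolutelyContinuousOnInterval_dist hp.le hT.le (γ s)
  have hac' : AbsolutelyContinuousOnInterval f s t := hac.mono <| by
    rw [uIcc_of_le hst', uIcc_of_le hT.le]; exact Icc_subset_Icc s.2.1 t.2.2
  have hftc : ∫ r in (s : ℝ)..t, deriv f r = dist (γ s) (γ t) := by
    rw [hac'.integral_deriv_eq_sub]; simp [hf]
  have hint : edist (γ s) (γ t) ≤ ∫⁻ r in Ioc (s : ℝ) t, ‖deriv f r‖ₑ := by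
    rw [edist_dist, ← hftc, intervalIntegral.integral_of_le hst']
    exact (Real.ofReal_le_enorm _).trans (enorm_integral_le_lintegral_enorm _)
  have hmeas : AEMeasurable (fun r => ‖deriv f r‖ₑ) (volume.restrict (Ioc (s : ℝ) t)) :=
    (measurable_deriv f).enorm.aemeasurable
  have hpow : ∫⁻ r in Ioc (s : ℝ) t, ‖deriv f r‖ₑ ^ p ≤ pAction p γ := by
    rw [pAction, if_pos hγ]
    have e : ∫⁻ r : Icc (0 : ℝ) T, metricDerivative γ r ^ p ∂(volume.comap Subtype.val)
        = ∫⁻ r in Icc (0 : ℝ) T, metricDerivative γ (projIcc 0 T hT.le r) ^ p := by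
      rw [← lintegral_subtype_comap measurableSet_Icc]
      simp
    rw [e]
    refine (lintegral_mono_ae ?_).trans (lintegral_mono_set hsub)
    rw [ae_restrict_iff' measurableSet_Ioc]
    filter_upwards [hac.ae_differentiableAt] with r hr hr'
    have hr0 := hsub hr'
    refine ENNReal.rpow_le_rpow ?_ hp0.le
    rw [projIcc_of_mem hT.le hr0]
    exact enorm_deriv_dist_le_metricDerivative hT γ (γ s) ⟨r, hr0⟩
      (hr (by rwa [uIcc_of_le hT.le]))
  have hpq : p.HolderConjugate (Real.conjExponent p) := Real.HolderConjugate.conjExponent hp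
  -- Hölder against the constant `1` produces the power of the interval length.
  have hhol := ENNReal.lintegral_mul_le_Lp_mul_Lq (volume.restrict (Ioc (s : ℝ) t)) hpq hmeas
    (g := fun _ => 1) aemeasurable_const
  simp only [Pi.mul_apply, mul_one, ENNReal.one_rpow, lintegral_const, Measure.restrict_apply,
    MeasurableSet.univ, univ_inter, Real.volume_Ioc, one_mul] at hhol
  have hq' : 1 / Real.conjExponent p = 1 - 1 / p := by
    rw [Real.conjExponent]; field_simp
  have hed : edist s t = ENNReal.ofReal (t - s) := by
    rw [Subtype.edist_eq, edist_comm, edist_dist, Real.dist_eq, abs_of_nonneg (by linarith)]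
  rw [hq', ← hed] at hhol
  refine hint.trans (hhol.trans ?_)
  rw [mul_comm]
  gcongr

end HoelderEstimate

/-! ### Measurable projection onto a finite set -/

section NearestPoint

variable {Y : Type*} [MetricSpace Y] [MeasurableSpace Y] [BorelSpace Y]

/-- There is a measurable nearest point map onto every nonempty finite set. -/
lemma Finset.exists_measurable_edist_eq_infEDist {F : Finset Y} (hF : F.Nonempty) :
    ∃ q : Y → Y, Measurable q ∧ (∀ x, q x ∈ F) ∧ ∀ x, edist x (q x) = Metric.infEDist x F := by
  classical
  induction hF using Finset.Nonempty.cons_induction with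
  | singleton a => exact ⟨fun _ => a, measurable_const, by simp, by simp⟩
  | cons a F ha hF ih =>
    obtain ⟨q, hq, hqF, hqd⟩ := ih
    have hins : ∀ x, Metric.infEDist x (Finset.cons a F ha : Finset Y)
        = min (edist x a) (Metric.infEDist x F) := by
      intro x
      rw [Finset.coe_cons, Set.insert_eq, Metric.infEDist_union, Metric.infEDist_singleton]
    refine ⟨fun x => if edist x a ≤ Metric.infEDist x F then a else q x,
      Measurable.ite (measurableSet_le (continuous_id.edist continuous_const).measurable
        Metric.continuous_infEDist.measurable) measurable_const hq, fun x => ?_, fun x => ?_⟩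
    · dsimp only
      split_ifs with h
      · simp
      · simp [hqF x]
    · dsimp only
      rw [hins]
      split_ifs with h
      · rw [min_eq_left h]
      · rw [min_eq_right (not_le.1 h).le, hqd]

end NearestPoint

/-! ### Total boundedness in `𝒫_p` through finite sets -/

section TotalBoundedness

variable {Y : Type*} [MetricSpace Y] [MeasurableSpace Y] [SecondCountableTopology Y] [BorelSpace Y]

/-- The `L^p`-norm of a nonnegative `1`-Lipschitz function is `1`-Lipschitz for `W_p`. -/
lemma lintegral_rpow_le_add_wassersteinDist {p : ℝ} (hp : 1 ≤ p) {μ ν : Measure Y} {g : Y → ℝ≥0∞}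
    (hg : Measurable g) (hlip : ∀ x y, g x ≤ g y + edist x y) :
    (∫⁻ x, g x ^ p ∂μ) ^ (1 / p)
      ≤ (∫⁻ x, g x ^ p ∂ν) ^ (1 / p) + wassersteinDist p μ ν := by
  have hp0 : 0 < p := by linarith
  refine ENNReal.le_of_forall_pos_le_add fun ε hε hfin => ?_
  obtain ⟨π, ⟨rfl, rfl⟩, hlt⟩ := exists_coupling_of_wassersteinDist_lt hp
    (ENNReal.lt_add_right (ENNReal.add_lt_top.1 hfin).2.ne
      (ENNReal.coe_ne_zero.2 hε.ne') : wassersteinDist p μ ν < _ + ε)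
  rw [Measure.fst, Measure.snd, lintegral_map (hg.pow_const p) measurable_fst,
    lintegral_map (hg.pow_const p) measurable_snd]
  calc (∫⁻ z, g z.1 ^ p ∂π) ^ (1 / p)
      ≤ (∫⁻ z, ((fun z : Y × Y => g z.2) + fun z : Y × Y => edist z.1 z.2) z ^ p ∂π)
          ^ (1 / p) := by
        gcongr with z
        exact hlip _ _
    _ ≤ (∫⁻ z, g z.2 ^ p ∂π) ^ (1 / p) + (∫⁻ z, edist z.1 z.2 ^ p ∂π) ^ (1 / p) :=
        ENNReal.lintegral_Lp_add_le (hg.comp measurable_snd).aemeasurable (by fun_prop) hp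
    _ ≤ _ := by
        rw [add_assoc]
        exact add_le_add le_rfl hlt.le

/-- A measure with finite `p`-moment is close in `L^p` to a finite set. -/
lemma WassersteinSpace.exists_finset_lintegral_infEDist_le {p : ℝ} (hp : 1 ≤ p)
    (μ : WassersteinSpace p Y) {ε : ℝ≥0∞} (hε : ε ≠ 0) :
    ∃ F : Finset Y, F.Nonempty ∧
      (∫⁻ x, Metric.infEDist x F ^ p ∂μ.toMeasure) ^ (1 / p) ≤ ε := by
  classical
  have hp0 : 0 < p := by linarith
  obtain ⟨x₀, hx₀⟩ := μ.moment
  have : Nonempty Y := ⟨x₀⟩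
  -- Keeping `x₀` in every `F n` makes the moment integrand a dominating function; the dense
  -- sequence gives pointwise convergence to `0`.
  set F : ℕ → Finset Y := fun n =>
    insert x₀ ((Finset.range n).image (TopologicalSpace.denseSeq Y)) with hF
  have hlim : Tendsto (fun n => ∫⁻ x, Metric.infEDist x (F n) ^ p ∂μ.toMeasure) atTop
      (𝓝 (∫⁻ _, 0 ∂μ.toMeasure)) := by
    refine tendsto_lintegral_of_dominated_convergence (fun x => edist x x₀ ^ p)
      (fun n => Metric.continuous_infEDist.measurable.pow_const p)
      (fun n => Eventually.of_forall fun x => ?_) hx₀.ne (Eventually.of_forall fun x => ?_)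
    · exact ENNReal.rpow_le_rpow (Metric.infEDist_le_edist_of_mem (by simp [hF])) hp0.le
    · have h : Tendsto (fun n => Metric.infEDist x (F n)) atTop (𝓝 0) := by
        refine ENNReal.tendsto_nhds_zero.2 fun δ hδ => ?_
        obtain ⟨_, ⟨k, rfl⟩, hk⟩ := EMetric.mem_closure_iff.1
          (TopologicalSpace.denseRange_denseSeq Y x) δ hδ
        filter_upwards [eventually_gt_atTop k] with n hn
        refine (Metric.infEDist_le_edist_of_mem ?_).trans hk.le
        simp only [hF, Finset.coe_insert, Finset.coe_image, Finset.coe_range]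
        exact Or.inr ⟨k, hn, rfl⟩
      have h2 := h.ennrpow_const p
      rwa [ENNReal.zero_rpow_of_pos hp0] at h2
  have hlim' := hlim.ennrpow_const (1 / p)
  rw [lintegral_zero, ENNReal.zero_rpow_of_pos (by positivity)] at hlim'
  obtain ⟨n, hn⟩ := (ENNReal.tendsto_nhds_zero.1 hlim' ε (pos_iff_ne_zero.2 hε)).exists
  exact ⟨F n, by simp [hF], hn⟩

/-- A totally bounded set of measures is uniformly close in `L^p` to a finite set. -/
lemma TotallyBounded.exists_finset_lintegral_infEDist_le [CompleteSpace Y] [Nonempty Y] {p : ℝ}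
    [hp : Fact (1 ≤ p)] {S : Set (WassersteinSpace p Y)} (hS : TotallyBounded S) {ε : ℝ≥0∞}
    (hε : ε ≠ 0) :
    ∃ F : Finset Y, F.Nonempty ∧ ∀ μ ∈ S,
      (∫⁻ x, Metric.infEDist x F ^ p ∂μ.toMeasure) ^ (1 / p) ≤ ε := by
  classical
  have hε2 : ε / 2 ≠ 0 := by simp [hε]
  obtain ⟨t, ht, hcov⟩ := EMetric.totallyBounded_iff.1 hS (ε / 2) (pos_iff_ne_zero.2 hε2)
  choose F hFne hF using fun μ : WassersteinSpace p Y =>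
    μ.exists_finset_lintegral_infEDist_le hp.out hε2
  obtain ⟨y₀⟩ := ‹Nonempty Y›
  -- The finite sets of the centres of an `ε/2`-net are merged; `y₀` keeps the union nonempty when
  -- the net is empty.
  refine ⟨insert y₀ (ht.toFinset.biUnion F), by simp, fun μ hμ => ?_⟩
  obtain ⟨ν, hν, hμν⟩ := mem_iUnion₂.1 (hcov hμ)
  have hsub : (F ν : Set Y) ⊆ (insert y₀ (ht.toFinset.biUnion F) : Finset Y) := by
    intro y hy
    simp only [Finset.coe_insert, Finset.coe_biUnion]
    exact Or.inr (mem_iUnion₂.2 ⟨ν, by simpa using hν, hy⟩)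
  have hp0 : 0 < p := by linarith [hp.out]
  calc _ ≤ (∫⁻ x, Metric.infEDist x (F ν) ^ p ∂μ.toMeasure) ^ (1 / p) := by
        gcongr
    _ ≤ (∫⁻ x, Metric.infEDist x (F ν) ^ p ∂ν.toMeasure) ^ (1 / p)
          + wassersteinDist p μ.toMeasure ν.toMeasure :=
        lintegral_rpow_le_add_wassersteinDist hp.out Metric.continuous_infEDist.measurable
          fun x y => Metric.infEDist_le_infEDist_add_edist
    _ ≤ ε / 2 + ε / 2 := add_le_add (hF ν) (le_of_lt hμν)
    _ = ε := ENNReal.add_halves ε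

/-- Two measures with a common part are close in `W_p` if the remainders have little mass and live
at bounded distance from each other. -/
lemma wassersteinDist_add_le {p : ℝ} (hp : 1 ≤ p) (ρ α β : Measure Y) [IsFiniteMeasure α]
    [IsFiniteMeasure β] (hmass : α univ = β univ) {D : ℝ≥0∞}
    (hD : ∀ᵐ x ∂α, ∀ᵐ y ∂β, edist x y ≤ D) :
    wassersteinDist p (ρ + α) (ρ + β) ≤ (D ^ p * α univ) ^ (1 / p) := by
  have hp0 : 0 < p := by linarith
  rcases eq_or_ne (α univ) 0 with h0 | h0
  · rw [Measure.measure_univ_eq_zero.1 h0, Measure.measure_univ_eq_zero.1 (hmass.symm.trans h0),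
      add_zero, wassersteinDist_self hp]
    exact zero_le
  have htop : α univ ≠ ∞ := measure_ne_top _ _
  have hdiag : Measurable fun x : Y => (x, x) := by fun_prop
  -- The common part stays in place along the diagonal, and the remainders are coupled by their
  -- normalized product.
  have hcoup : ρ.map (fun x => (x, x)) + (α univ)⁻¹ • α.prod β ∈ couplings (ρ + α) (ρ + β) := by
    constructor
    · rw [Measure.fst_add, Measure.fst, Measure.map_map measurable_fst hdiag, Measure.fst,
        Measure.map_smul, Measure.map_fst_prod, ← hmass, smul_smul, ENNReal.inv_mul_cancel h0 htop,
        one_smul]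
      congr 1
      exact Measure.map_id
    · rw [Measure.snd_add, Measure.snd, Measure.map_map measurable_snd hdiag, Measure.snd,
        Measure.map_smul, Measure.map_snd_prod, smul_smul, ENNReal.inv_mul_cancel h0 htop,
        one_smul]
      congr 1
      exact Measure.map_id
  refine (wassersteinDist_le hp hcoup).trans (ENNReal.rpow_le_rpow ?_ (by positivity))
  rw [lintegral_add_measure, lintegral_smul_measure, lintegral_map (by fun_prop) hdiag,
    lintegral_prod _ (by fun_prop)]
  simp only [edist_self, ENNReal.zero_rpow_of_pos hp0, lintegral_zero, zero_add, smul_eq_mul]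
  calc (α univ)⁻¹ * ∫⁻ x, ∫⁻ y, edist x y ^ p ∂β ∂α
      ≤ (α univ)⁻¹ * ∫⁻ _, ∫⁻ _, D ^ p ∂β ∂α := by
        refine mul_le_mul_right ?_ _
        refine lintegral_mono_ae (hD.mono fun x hx => lintegral_mono_ae (hx.mono fun y hy => ?_))
        exact ENNReal.rpow_le_rpow hy hp0.le
    _ = D ^ p * α univ := by
        rw [lintegral_const, lintegral_const, ← hmass, mul_comm, mul_assoc, mul_assoc,
          ENNReal.mul_inv_cancel h0 htop, mul_one]

/-- The probability measure `∑ w_y δ_y` for weights `w` in the simplex over a finite set. -/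
noncomputable def finiteWassersteinMeasure (p : ℝ) (hp : 0 ≤ p) (F : Finset Y)
    (w : stdSimplex ℝ F) : WassersteinSpace p Y where
  toMeasure := ∑ y, ENNReal.ofReal (w.1 y) • Measure.dirac (y : Y)
  isProb := ⟨by
    simp only [Measure.coe_finsetSum, Measure.coe_smul, Finset.sum_apply, Pi.smul_apply,
      measure_univ, smul_eq_mul, mul_one]
    rw [← ENNReal.ofReal_sum_of_nonneg fun y _ => w.2.1 y, w.2.2, ENNReal.ofReal_one]⟩
  moment := by
    have hne : Nonempty F := by
      by_contra h
      have := w.2.2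
      rw [not_nonempty_iff] at h
      simp at this
    refine ⟨hne.some, ?_⟩
    rw [lintegral_finsetSum_measure]
    refine ENNReal.sum_lt_top.2 fun y _ => ?_
    have hm : Measurable fun x : Y => edist x hne.some ^ p :=
      (continuous_id.edist continuous_const).measurable.pow_const p
    rw [lintegral_smul_measure, lintegral_dirac' _ hm]
    exact ENNReal.mul_lt_top ENNReal.ofReal_lt_top
      (ENNReal.rpow_lt_top_of_nonneg hp (edist_ne_top _ _))

/-- Weights `v` and `w` share the mass `min v w`. The remainders have equal mass, which tends to `0`
as `v → w`, and it travels at most the diameter of `F`. -/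
lemma continuous_finiteWassersteinMeasure [CompleteSpace Y] {p : ℝ} [hp : Fact (1 ≤ p)]
    (hp' : 0 ≤ p) (F : Finset Y) : Continuous (finiteWassersteinMeasure p hp' F) := by
  have hp0 : 0 < p := by linarith [hp.out]
  refine continuous_iff_continuousAt.2 fun w => tendsto_iff_edist_tendsto_0.2 ?_
  set D := Metric.ediam (F : Set Y)
  have hDtop : D ≠ ∞ := F.finite_toSet.isBounded.ediam_ne_top
  set m : stdSimplex ℝ F → ℝ≥0∞ := fun v => ∑ y, ENNReal.ofReal (v.1 y - min (v.1 y) (w.1 y))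
  have hle : ∀ v, edist (finiteWassersteinMeasure p hp' F v) (finiteWassersteinMeasure p hp' F w)
      ≤ (D ^ p * m v) ^ (1 / p) := by
    intro v
    set ρ : Measure Y := ∑ y : F, ENNReal.ofReal (min (v.1 y) (w.1 y)) • Measure.dirac (y : Y)
    set α : Measure Y :=
      ∑ y : F, ENNReal.ofReal (v.1 y - min (v.1 y) (w.1 y)) • Measure.dirac (y : Y)
    set β : Measure Y :=
      ∑ y : F, ENNReal.ofReal (w.1 y - min (v.1 y) (w.1 y)) • Measure.dirac (y : Y)
    have hsplit : ∀ (a b : F → ℝ), (∀ y, 0 ≤ b y) → (∀ y, b y ≤ a y) →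
        ∑ y : F, ENNReal.ofReal (a y) • Measure.dirac (y : Y)
          = ∑ y : F, ENNReal.ofReal (b y) • Measure.dirac (y : Y)
            + ∑ y : F, ENNReal.ofReal (a y - b y) • Measure.dirac (y : Y) := by
      intro a b h0 hab
      rw [← Finset.sum_add_distrib]
      refine Finset.sum_congr rfl fun y _ => ?_
      rw [← add_smul, ← ENNReal.ofReal_add (h0 y) (sub_nonneg.2 (hab y)), add_sub_cancel]
    have huniv : ∀ a : F → ℝ, (∑ y : F, ENNReal.ofReal (a y) • Measure.dirac (y : Y)) univ
        = ∑ y, ENNReal.ofReal (a y) := by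
      intro a
      simp
    have hsupp : ∀ a : F → ℝ, ∀ᵐ x ∂(∑ y : F, ENNReal.ofReal (a y) • Measure.dirac (y : Y)),
        x ∈ F := by
      intro a
      rw [ae_iff]
      simp only [Measure.coe_finsetSum, Finset.sum_apply, Measure.smul_apply, smul_eq_mul]
      refine Finset.sum_eq_zero fun y _ => ?_
      rw [show {x | x ∉ F} = (F : Set Y)ᶜ from rfl, Measure.dirac_apply' _ F.measurableSet.compl]
      simp
    have hmin0 : ∀ y, 0 ≤ min (v.1 y) (w.1 y) := fun y => le_min (v.2.1 y) (w.2.1 y)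
    have hv : (finiteWassersteinMeasure p hp' F v).toMeasure = ρ + α :=
      hsplit _ _ hmin0 fun y => min_le_left _ _
    have hw : (finiteWassersteinMeasure p hp' F w).toMeasure = ρ + β :=
      hsplit _ _ hmin0 fun y => min_le_right _ _
    have hα : IsFiniteMeasure α := ⟨by rw [huniv]; simp⟩
    have hβ : IsFiniteMeasure β := ⟨by rw [huniv]; simp⟩
    have hmass : α univ = β univ := by
      rw [huniv, huniv, ← ENNReal.ofReal_sum_of_nonneg fun y _ => sub_nonneg.2 (min_le_left _ _),
        ← ENNReal.ofReal_sum_of_nonneg fun y _ => sub_nonneg.2 (min_le_right _ _),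
        Finset.sum_sub_distrib, Finset.sum_sub_distrib, v.2.2, w.2.2]
    have h := wassersteinDist_add_le hp.out ρ α β hmass (D := D) <| by
      filter_upwards [hsupp _] with x hx
      filter_upwards [hsupp _] with y hy
      exact Metric.edist_le_ediam_of_mem hx hy
    rw [← hv, ← hw, huniv] at h
    exact h
  have hm : Tendsto (fun v => (D ^ p * m v) ^ (1 / p)) (𝓝 w) (𝓝 0) := by
    have hc : Continuous fun v => (D ^ p * m v) ^ (1 / p) := by
      refine (ENNReal.continuous_rpow_const).comp
        ((ENNReal.continuous_const_mul (ENNReal.rpow_ne_top_of_nonneg hp' hDtop)).comp ?_)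
      refine continuous_finsetSum _ fun y _ => ENNReal.continuous_ofReal.comp ?_
      have hy : Continuous fun v : stdSimplex ℝ F => v.1 y :=
        (continuous_apply y).comp continuous_subtype_val
      exact hy.sub (hy.min continuous_const)
    have := hc.tendsto w
    simpa [m, hp0] using this
  exact tendsto_of_tendsto_of_tendsto_of_le_of_le tendsto_const_nhds hm (fun _ => zero_le) hle

/-- Projecting a measure to a finite set costs at most the `L^p`-distance to the set. -/
lemma WassersteinSpace.exists_edist_finiteWassersteinMeasure_le [CompleteSpace Y] {p : ℝ}
    [hp : Fact (1 ≤ p)] (hp' : 0 ≤ p) (μ : WassersteinSpace p Y) {F : Finset Y}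
    (hF : F.Nonempty) :
    ∃ w, edist μ (finiteWassersteinMeasure p hp' F w)
      ≤ (∫⁻ x, Metric.infEDist x F ^ p ∂μ.toMeasure) ^ (1 / p) := by
  classical
  -- The weights are the masses of the fibres of a nearest point map `q`; the coupling is the law of
  -- `(x, q x)`.
  obtain ⟨q, hq, hqF, hqd⟩ := F.exists_measurable_edist_eq_infEDist hF
  have hpre : ∀ y : Y, MeasurableSet (q ⁻¹' {y}) := fun y => hq (measurableSet_singleton y)
  have hsum : ∀ G : Finset Y, ∑ y ∈ G, μ.toMeasure (q ⁻¹' {y}) = μ.toMeasure (q ⁻¹' G) :=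
    fun G => sum_measure_preimage_singleton G fun y _ => hpre y
  have hone : ∑ y : F, μ.toMeasure (q ⁻¹' {(y : Y)}) = 1 := by
    rw [Finset.sum_coe_sort F fun y => μ.toMeasure (q ⁻¹' {y}), hsum,
      show q ⁻¹' (F : Set Y) = univ from eq_univ_of_forall hqF, measure_univ]
  refine ⟨⟨fun y => (μ.toMeasure (q ⁻¹' {(y : Y)})).toReal, fun y => ENNReal.toReal_nonneg, ?_⟩, ?_⟩
  · rw [← ENNReal.toReal_sum fun y _ => measure_ne_top _ _, hone, ENNReal.toReal_one]
  · have hmap : μ.toMeasure.map q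
        = ∑ y : F, ENNReal.ofReal (μ.toMeasure (q ⁻¹' {(y : Y)})).toReal
            • Measure.dirac (y : Y) := by
      ext s hs
      have hset : q ⁻¹' s = q ⁻¹' ((F.filter (· ∈ s) : Finset Y) : Set Y) := by
        ext x
        simp [hqF x]
      rw [Measure.map_apply hq hs, hset, ← hsum, Finset.sum_filter, ← Finset.sum_coe_sort F]
      simp only [Measure.coe_finsetSum, Finset.sum_apply, Measure.smul_apply, smul_eq_mul,
        Measure.dirac_apply' _ hs]
      refine Finset.sum_congr rfl fun y _ => ?_
      rw [ENNReal.ofReal_toReal (measure_ne_top _ _)]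
      by_cases hy : (y : Y) ∈ s <;> simp [hy]
    have hm : Measurable fun x => (x, q x) := measurable_id.prodMk hq
    have hcoup : μ.toMeasure.map (fun x => (x, q x))
        ∈ couplings μ.toMeasure (μ.toMeasure.map q) := by
      constructor
      · rw [Measure.fst, Measure.map_map measurable_fst hm]
        exact Measure.map_id
      · rw [Measure.snd, Measure.map_map measurable_snd hm]
        rfl
    have h := wassersteinDist_le hp.out hcoup
    rw [lintegral_map (by fun_prop) hm] at h
    simp only [hqd] at h
    rw [hmap] at h
    exact h

/-- A set of measures that is uniformly close in `L^p` to finite sets is totally bounded. -/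
lemma totallyBounded_of_exists_finset_lintegral_infEDist_le [CompleteSpace Y] {p : ℝ}
    [hp : Fact (1 ≤ p)] {S : Set (WassersteinSpace p Y)}
    (h : ∀ ε : ℝ≥0∞, ε ≠ 0 → ∃ F : Finset Y, F.Nonempty ∧ ∀ μ ∈ S,
      (∫⁻ x, Metric.infEDist x F ^ p ∂μ.toMeasure) ^ (1 / p) ≤ ε) :
    TotallyBounded S := by
  have hp' : 0 ≤ p := by linarith [hp.out]
  refine EMetric.totallyBounded_iff.2 fun ε hε => ?_
  obtain ⟨δ, hδ, hδε⟩ := exists_between hε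
  have hδ2 : δ / 2 ≠ 0 := by simp [hδ.ne']
  obtain ⟨F, hF, hFS⟩ := h (δ / 2) hδ2
  have : CompactSpace (stdSimplex ℝ F) := isCompact_iff_compactSpace.1 (isCompact_stdSimplex ℝ F)
  obtain ⟨t, ht, hcov⟩ := EMetric.totallyBounded_iff.1
    (isCompact_range (continuous_finiteWassersteinMeasure hp' F)).totallyBounded (δ / 2)
    (pos_iff_ne_zero.2 hδ2)
  refine ⟨t, ht, fun μ hμ => ?_⟩
  obtain ⟨w, hw⟩ := μ.exists_edist_finiteWassersteinMeasure_le hp' hF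
  obtain ⟨ν, hν, hwν⟩ := mem_iUnion₂.1 (hcov (mem_range_self w))
  refine mem_iUnion₂.2 ⟨ν, hν, lt_of_le_of_lt ?_ hδε⟩
  calc edist μ ν ≤ edist μ (finiteWassersteinMeasure p hp' F w)
        + edist (finiteWassersteinMeasure p hp' F w) ν := edist_triangle _ _ _
    _ ≤ δ / 2 + δ / 2 := add_le_add (hw.trans (hFS μ hμ)) (le_of_lt hwν)
    _ = δ := ENNReal.add_halves δ

end TotalBoundedness

/-! ### Completeness of the Wasserstein space -/

section Completeness

/-- Reparametrizing a kernel by a function of the first variable pushes forward the first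
marginal. -/
lemma MeasureTheory.Measure.map_compProd_comap {α β γ : Type*} [MeasurableSpace α]
    [MeasurableSpace β] [MeasurableSpace γ] (ν : Measure α) [SFinite ν] (κ : Kernel β γ)
    [IsSFiniteKernel κ] {f : α → β} (hf : Measurable f) :
    (ν ⊗ₘ κ.comap f hf).map (fun z => (f z.1, z.2)) = ν.map f ⊗ₘ κ := by
  ext s hs
  have hm : Measurable fun z : α × γ => (f z.1, z.2) := by fun_prop
  rw [Measure.map_apply hm hs, Measure.compProd_apply (hm hs), Measure.compProd_apply hs,
    lintegral_map (Kernel.measurable_kernel_prodMk_left hs) hf]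
  rfl

variable {Y : Type*} [MetricSpace Y] [MeasurableSpace Y] [SecondCountableTopology Y] [BorelSpace Y]
  [CompleteSpace Y]

/-- A sequence of consecutive couplings is realized by a single random sequence. -/
lemma exists_measure_pi_map_eq_couplings {μ : ℕ → Measure Y} [∀ n, IsProbabilityMeasure (μ n)]
    {π : ℕ → Measure (Y × Y)} (hπ : ∀ n, π n ∈ couplings (μ n) (μ (n + 1))) :
    ∃ P : Measure (ℕ → Y), IsProbabilityMeasure P ∧
      ∀ n, P.map (fun x => (x n, x (n + 1))) = π n := by
  have : Nonempty Y := nonempty_of_isProbabilityMeasure (μ 0)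
  have hprob : ∀ n, IsProbabilityMeasure (π n) := fun n =>
    ⟨by rw [← Measure.fst_univ, (hπ n).1]; exact measure_univ⟩
  let ev : ∀ n : ℕ, (Finset.Iic n → Y) → Y := fun n x => x ⟨n, Finset.mem_Iic.2 le_rfl⟩
  have hev : ∀ n, Measurable (ev n) := fun n => measurable_pi_apply _
  -- Markov chain: the step after time `n` sees only the last coordinate and follows the
  -- disintegration of `π n`. The Ionescu-Tulcea theorem gives the law of the whole sequence.
  let κ : ∀ n : ℕ, Kernel (Finset.Iic n → Y) Y := fun n => (π n).condKernel.comap (ev n) (hev n)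
  have hκ : ∀ n, IsMarkovKernel (κ n) := fun n => Kernel.IsMarkovKernel.comap _ _
  let P : Measure (ℕ → Y) := Kernel.trajMeasure (X := fun _ => Y) (μ 0) κ
  have hstep : ∀ n, P.map (fun x => (x n, x (n + 1)))
      = P.map (fun x => x n) ⊗ₘ (π n).condKernel := by
    intro n
    have hr : Measurable (Preorder.frestrictLe (π := fun _ : ℕ => Y) n) := by fun_prop
    have h := Kernel.map_frestrictLe_trajMeasure_compProd_eq_map_trajMeasure (X := fun _ => Y)
      (κ := κ) (μ₀ := μ 0) (a := n)
    have h2 := Measure.map_compProd_comap (P.map (Preorder.frestrictLe n)) (π n).condKernel (hev n)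
    rw [Measure.map_map (hev n) hr] at h2
    refine Eq.trans ?_ h2
    change _ = Measure.map _ (P.map (Preorder.frestrictLe n) ⊗ₘ κ n)
    rw [h, Measure.map_map (by fun_prop) (by fun_prop)]
    rfl
  have hmarg : ∀ n, P.map (fun x => x n) = μ n := by
    intro n
    induction n with
    | zero =>
      have hr : Measurable (Preorder.frestrictLe (π := fun _ : ℕ => Y) 0) := by fun_prop
      have h : P.map (Preorder.frestrictLe 0)
          = (μ 0).map (MeasurableEquiv.piUnique (fun _ : Finset.Iic 0 => Y)).symm := by
        have hP : P = Kernel.traj (X := fun _ => Y) κ 0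
            ∘ₘ (μ 0).map (MeasurableEquiv.piUnique (fun _ : Finset.Iic 0 => Y)).symm := rfl
        rw [hP, Measure.map_comp _ _ hr,
          Kernel.traj_map_frestrictLe, Kernel.partialTraj_self, Measure.id_comp]
      have h2 := congrArg (Measure.map (ev 0)) h
      rw [Measure.map_map (hev 0) hr, Measure.map_map (hev 0) (by fun_prop)] at h2
      exact h2.trans Measure.map_id
    | succ n ih =>
      have h := congrArg Measure.snd (hstep n)
      rw [ih, ← (hπ n).1, (π n).disintegrate, (hπ n).2, Measure.snd,
        Measure.map_map measurable_snd (by fun_prop)] at h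
      exact h
  refine ⟨P, inferInstanceAs (IsProbabilityMeasure (Kernel.trajMeasure _ _)), fun n => ?_⟩
  rw [hstep, hmarg, ← (hπ n).1, (π n).disintegrate]

/-- A sequence of random variables whose consecutive `L^p`-distances are bounded by `2^{-n}`
converges almost surely and in `L^p`. -/
lemma exists_measurable_lintegral_edist_rpow_le {p : ℝ} (hp : 1 ≤ p) {P : Measure (ℕ → Y)}
    [IsProbabilityMeasure P]
    (hP : ∀ n, (∫⁻ x, edist (x n) (x (n + 1)) ^ p ∂P) ^ (1 / p) ≤ (2 : ℝ≥0∞)⁻¹ ^ n) :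
    ∃ Z : (ℕ → Y) → Y, Measurable Z ∧
      ∀ n, (∫⁻ x, edist (x n) (Z x) ^ p ∂P) ^ (1 / p) ≤ 2 * (2 : ℝ≥0∞)⁻¹ ^ n := by
  have hp0 : 0 < p := by linarith
  have : Nonempty (ℕ → Y) := nonempty_of_isProbabilityMeasure P
  have : Nonempty Y := this.map fun x => x 0
  have hm : ∀ n m : ℕ, Measurable fun x : ℕ → Y => edist (x n) (x m) := by
    intro n m; fun_prop
  -- On a probability space the `L^1` norm is at most the `L^p` norm, so the increments are summable
  -- almost surely and almost every sequence is Cauchy.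
  have hL1 : ∀ n, ∫⁻ x, edist (x n) (x (n + 1)) ∂P ≤ (2 : ℝ≥0∞)⁻¹ ^ n := by
    intro n
    refine le_trans ?_ (hP n)
    have h := eLpNorm_le_eLpNorm_of_exponent_le (μ := P)
      (f := fun x : ℕ → Y => edist (x n) (x (n + 1))) (p := 1) (q := ENNReal.ofReal p)
      (by simpa using hp) (hm n (n + 1)).aestronglyMeasurable
    rw [eLpNorm_one_eq_lintegral_enorm, eLpNorm_eq_lintegral_rpow_enorm_toReal
      (by simpa using hp0) ENNReal.ofReal_ne_top, ENNReal.toReal_ofReal hp0.le] at h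
    simpa using h
  have hsum : ∀ᵐ x ∂P, ∑' n, edist (x n) (x (n + 1)) ≠ ∞ := by
    have h : ∫⁻ x, ∑' n, edist (x n) (x (n + 1)) ∂P ≠ ∞ := by
      rw [lintegral_tsum fun n => (hm n (n + 1)).aemeasurable]
      refine ne_top_of_le_ne_top ?_ (ENNReal.tsum_le_tsum hL1)
      rw [ENNReal.tsum_geometric_two]
      exact ENNReal.ofNat_ne_top
    filter_upwards [ae_lt_top (Measurable.tsum fun n => hm n (n + 1)) h] with x hx using hx.ne
  have hconv : ∀ᵐ x ∂P, ∃ y, Tendsto (fun n => x n) atTop (𝓝 y) := by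
    filter_upwards [hsum] with x hx
    exact cauchySeq_tendsto_of_complete
      (cauchySeq_of_edist_le_of_tsum_ne_top _ (fun n => le_rfl) hx)
  obtain ⟨Z, hZ, hlim⟩ := measurable_limit_of_tendsto_metrizable_ae
    (f := fun n (x : ℕ → Y) => x n) (L := atTop) (fun n => (measurable_pi_apply n).aemeasurable)
    hconv
  refine ⟨Z, hZ, fun n => ?_⟩
  have hfin : ∀ k, (∫⁻ x, edist (x n) (x (n + k)) ^ p ∂P) ^ (1 / p)
      ≤ ∑ j ∈ Finset.range k, (2 : ℝ≥0∞)⁻¹ ^ (n + j) := by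
    intro k
    induction k with
    | zero => simp [hp0]
    | succ k ih =>
      rw [Finset.sum_range_succ]
      calc (∫⁻ x, edist (x n) (x (n + (k + 1))) ^ p ∂P) ^ (1 / p)
          ≤ (∫⁻ x, ((fun x : ℕ → Y => edist (x n) (x (n + k)))
              + fun x : ℕ → Y => edist (x (n + k)) (x (n + k + 1))) x ^ p ∂P) ^ (1 / p) := by
            gcongr with x
            exact edist_triangle _ _ _
        _ ≤ _ := ENNReal.lintegral_Lp_add_le (hm _ _).aemeasurable (hm _ _).aemeasurable hp
        _ ≤ _ := add_le_add ih (hP (n + k))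
  have hgeom : ∀ k, ∑ j ∈ Finset.range k, (2 : ℝ≥0∞)⁻¹ ^ (n + j) ≤ 2 * (2 : ℝ≥0∞)⁻¹ ^ n := by
    intro k
    simp only [pow_add, ← Finset.mul_sum]
    rw [mul_comm]
    gcongr
    exact (ENNReal.sum_le_tsum _).trans_eq ENNReal.tsum_geometric_two
  rw [one_div, ENNReal.rpow_inv_le_iff hp0]
  -- Fatou's lemma carries the uniform bound on `d(x_n, x_{n+k})` to the limit `k → ∞`.
  calc ∫⁻ x, edist (x n) (Z x) ^ p ∂P
      = ∫⁻ x, liminf (fun k => edist (x n) (x (n + k)) ^ p) atTop ∂P := by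
        refine lintegral_congr_ae (hlim.mono fun x hx => ?_)
        have h1 : Tendsto (fun k => x (n + k)) atTop (𝓝 (Z x)) := by
          simpa only [add_comm n, Function.comp_def] using hx.comp (tendsto_add_atTop_nat n)
        exact ((tendsto_const_nhds.edist h1).ennrpow_const p).liminf_eq.symm
    _ ≤ liminf (fun k => ∫⁻ x, edist (x n) (x (n + k)) ^ p ∂P) atTop :=
        lintegral_liminf_le fun k => (hm _ _).pow_const p
    _ ≤ liminf (fun _ : ℕ => (2 * (2 : ℝ≥0∞)⁻¹ ^ n) ^ p) atTop := by
        refine liminf_le_liminf (Eventually.of_forall fun k => ?_)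
        have := (hfin k).trans (hgeom k)
        rwa [one_div, ENNReal.rpow_inv_le_iff hp0] at this
    _ = _ := liminf_const _

/-- The Wasserstein space over a complete separable metric space is complete. -/
instance WassersteinSpace.instCompleteSpace {p : ℝ} [hp : Fact (1 ≤ p)] :
    CompleteSpace (WassersteinSpace p Y) := by
  have hp1 : 1 ≤ p := hp.out
  have hp0 : 0 < p := by linarith
  -- Only sequences with geometrically controlled distances need a limit; it will be the law of the
  -- almost sure limit `Z`.
  refine EMetric.complete_of_convergent_controlled_sequences (fun n => (2 : ℝ≥0∞)⁻¹ ^ n)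
    (fun n => ENNReal.pow_pos (by simp) n) fun u hu => ?_
  choose π hπ hlt using fun n => exists_coupling_of_wassersteinDist_lt hp1
    (hu n n (n + 1) le_rfl n.le_succ)
  obtain ⟨P, hPprob, hP⟩ := exists_measure_pi_map_eq_couplings hπ
  have hpair : ∀ n m : ℕ, Measurable fun x : ℕ → Y => (x n, x m) := by
    intro n m; fun_prop
  obtain ⟨Z, hZ, hPZ⟩ := exists_measurable_lintegral_edist_rpow_le hp1 (P := P) fun n => by
    have := (hlt n).le
    rwa [← hP n, lintegral_map (by fun_prop) (hpair _ _)] at this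
  have hmarg : ∀ n, P.map (fun x => x n) = (u n).toMeasure := by
    intro n
    rw [← (hπ n).1, ← hP n, Measure.fst, Measure.map_map measurable_fst (hpair _ _)]
    rfl
  have hcoup : ∀ n, P.map (fun x => (x n, Z x)) ∈ couplings (u n).toMeasure (P.map Z) := by
    intro n
    have hm : Measurable fun x : ℕ → Y => (x n, Z x) := (measurable_pi_apply n).prodMk hZ
    constructor
    · rw [Measure.fst, Measure.map_map measurable_fst hm, ← hmarg]
      rfl
    · rw [Measure.snd, Measure.map_map measurable_snd hm]
      rfl
  have hdist : ∀ n, wassersteinDist p (u n).toMeasure (P.map Z) ≤ 2 * (2 : ℝ≥0∞)⁻¹ ^ n := by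
    intro n
    refine (wassersteinDist_le hp1 (hcoup n)).trans ?_
    rw [lintegral_map (by fun_prop) ((measurable_pi_apply n).prodMk hZ)]
    exact hPZ n
  obtain ⟨x₀, hx₀⟩ := (u 0).moment
  have hmom : ∫⁻ y, edist y x₀ ^ p ∂(P.map Z) < ∞ := by
    have h := lintegral_rpow_le_add_wassersteinDist hp1 (μ := P.map Z) (ν := (u 0).toMeasure)
      (g := fun y => edist y x₀) (continuous_id.edist continuous_const).measurable
      fun x y => by rw [add_comm]; exact edist_triangle _ _ _
    have h2 : (∫⁻ y, edist y x₀ ^ p ∂(P.map Z)) ^ (1 / p) < ∞ := by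
      refine h.trans_lt (ENNReal.add_lt_top.2 ⟨?_, ?_⟩)
      · exact ENNReal.rpow_lt_top_of_nonneg (by positivity) hx₀.ne
      · rw [wassersteinDist_comm]
        exact (hdist 0).trans_lt (by simp)
    rwa [ENNReal.rpow_lt_top_iff_of_pos (by positivity)] at h2
  refine ⟨⟨P.map Z, Measure.isProbabilityMeasure_map hZ.aemeasurable, x₀, hmom⟩,
    tendsto_iff_edist_tendsto_0.2 ?_⟩
  have hlim : Tendsto (fun n : ℕ => 2 * (2 : ℝ≥0∞)⁻¹ ^ n) atTop (𝓝 0) := by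
    have := ENNReal.Tendsto.const_mul (a := 2)
      (ENNReal.tendsto_pow_atTop_nhds_zero_of_lt_one (r := 2⁻¹) (by simp)) (Or.inr (by simp))
    simpa using this
  exact tendsto_of_tendsto_of_tendsto_of_le_of_le tendsto_const_nhds hlim (fun _ => zero_le) hdist

end Completeness

/-! ### From marginals to measures on curves -/

section Lifting

/-- Small positive numbers make `a * x ^ r` small. -/
lemma ENNReal.exists_mul_rpow_le {a θ : ℝ≥0∞} (ha : a ≠ ∞) (hθ : θ ≠ 0) {r : ℝ} (hr : 0 < r) :
    ∃ x : ℝ≥0∞, x ≠ 0 ∧ x ≠ ∞ ∧ a * x ^ r ≤ θ := by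
  have ha1 : a + 1 ≠ ∞ := by finiteness
  -- The cap at `1` and the shift by `1` keep the quotient positive and finite even for `θ = ∞` or
  -- `a = 0`.
  have h1 : min θ 1 / (a + 1) ≠ 0 := ENNReal.div_ne_zero.2 ⟨by simp [hθ], ha1⟩
  have h2 : min θ 1 / (a + 1) ≠ ∞ := ENNReal.div_ne_top (by simp) (by simp)
  refine ⟨(min θ 1 / (a + 1)) ^ r⁻¹, ?_, ?_, ?_⟩
  · exact (ENNReal.rpow_pos (pos_iff_ne_zero.2 h1) h2).ne'
  · exact ENNReal.rpow_ne_top_of_nonneg (by positivity) h2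
  · rw [ENNReal.rpow_inv_rpow hr.ne']
    calc a * (min θ 1 / (a + 1)) ≤ (a + 1) * (min θ 1 / (a + 1)) := by
          gcongr
          exact le_self_add
      _ ≤ min θ 1 := ENNReal.mul_div_le
      _ ≤ θ := min_le_left _ _

variable {X : Type*} [MetricSpace X] {T : ℝ}

/-- Finitely many curves approximate every curve `γ`, with an error that is controlled by the
distance of `γ` from a finite set at the times of a `δ`-net and by the action of `γ`. -/
lemma exists_finset_infEDist_path_le {p : ℝ} (hp : 1 < p) (hT : 0 < T)
    {I : Finset (Icc (0 : ℝ) T)} {δ : ℝ≥0∞} (hI : ∀ t, ∃ s ∈ I, edist t s ≤ δ) {F : Finset X}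
    (hF : F.Nonempty) {ε : ℝ≥0∞} (hε : ε ≠ 0) :
    ∃ G : Finset C(Icc (0 : ℝ) T, X), G.Nonempty ∧ ∀ γ : C(Icc (0 : ℝ) T, X), Metric.infEDist γ G
      ≤ 2 * ((⨆ i : I, Metric.infEDist (γ i) F) + δ ^ (1 - 1 / p) * pAction p γ ^ (1 / p)) + ε := by
  classical
  have hp0 : 0 < p := by linarith
  have hq : 0 ≤ 1 - 1 / p := by
    rw [sub_nonneg, div_le_one hp0]; exact hp.le
  have : Nonempty F := hF.to_subtype
  have : Nonempty C(Icc (0 : ℝ) T, X) := ⟨ContinuousMap.const _ hF.choose⟩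
  -- `J c γ` bounds, at every time `t`, the distance from `γ t` to the value of `c` at a net time
  -- near `t`.
  let J : (I → F) → C(Icc (0 : ℝ) T, X) → ℝ≥0∞ := fun c γ =>
    (⨆ i : I, edist (γ i) (c i : X)) + δ ^ (1 - 1 / p) * pAction p γ ^ (1 / p)
  -- Near-minimizers suffice, whence the slack `ε`; if the infimum is infinite, any curve serves.
  have hJ : ∀ c, ∃ γ₀, ∀ γ, J c γ₀ ≤ J c γ + ε := by
    intro c
    rcases eq_or_ne (⨅ γ, J c γ) ∞ with h | h
    · refine ⟨Classical.arbitrary _, fun γ => ?_⟩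
      rw [iInf_eq_top.1 h γ, top_add]
      exact le_top
    · obtain ⟨γ₀, hγ₀⟩ := exists_lt_of_ciInf_lt (ENNReal.lt_add_right h hε)
      exact ⟨γ₀, fun γ => hγ₀.le.trans (add_le_add (iInf_le _ _) le_rfl)⟩
  choose r hr using hJ
  refine ⟨Finset.univ.image r, Finset.univ_nonempty.image r, fun γ => ?_⟩
  choose y hyF hy using fun i : I =>
    F.finite_toSet.isCompact.exists_infEDist_eq_edist (by simpa using hF) (γ i)
  let c : I → F := fun i => ⟨y i, hyF i⟩
  have hJc : J c γ
      = (⨆ i : I, Metric.infEDist (γ i) F) + δ ^ (1 - 1 / p) * pAction p γ ^ (1 / p) := by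
    simp only [J, hy, c]
  rw [← hJc]
  refine (Metric.infEDist_le_edist_of_mem (y := r c) (by simp)).trans ?_
  -- Both curves are compared with `c` at the same net time. Near-minimality then replaces `J c (r
  -- c)` by `J c γ + ε`, which explains the factor `2`.
  have hbound : edist γ (r c) ≤ J c γ + J c (r c) := by
    rw [ContinuousMap.edist_eq_iSup]
    refine iSup_le fun t => ?_
    obtain ⟨s, hs, hts⟩ := hI t
    have hnear : ∀ γ' : C(Icc (0 : ℝ) T, X), edist (γ' t) (c ⟨s, hs⟩ : X) ≤ J c γ' := by
      intro γ'
      refine (edist_triangle_left _ _ (γ' s)).trans ?_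
      rw [add_comm]
      refine add_le_add (le_iSup (fun i : I => edist (γ' i) (c i : X)) ⟨s, hs⟩) ?_
      rw [edist_comm]
      refine (edist_le_edist_rpow_mul_pAction hp hT γ' t s).trans ?_
      gcongr
    exact (edist_triangle_right _ _ _).trans (add_le_add (hnear γ) (hnear (r c)))
  calc edist γ (r c) ≤ J c γ + (J c γ + ε) := hbound.trans (add_le_add le_rfl (hr c γ))
    _ = 2 * J c γ + ε := by ring

variable [MeasurableSpace X] [BorelSpace X]

/-- If the actions are bounded and the marginals are uniformly close in `L^p` to finite sets, then
so are the measures on curves. -/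
lemma exists_finset_lintegral_infEDist_path_le {p : ℝ} [Fact (1 ≤ p)] (hp : 1 < p) (hT : 0 < T)
    {K : Set (WassersteinSpace p C(Icc (0 : ℝ) T, X))} {A : ℝ≥0∞} (hA : A ≠ ∞)
    (hK : ∀ η ∈ K, ∫⁻ γ, pAction p γ ∂η.toMeasure ≤ A)
    (hM : ∀ ε : ℝ≥0∞, ε ≠ 0 → ∃ F : Finset X, F.Nonempty ∧ ∀ η ∈ K, ∀ t,
      (∫⁻ x, Metric.infEDist x F ^ p ∂(marginal η t).toMeasure) ^ (1 / p) ≤ ε)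
    {ε : ℝ≥0∞} (hε : ε ≠ 0) :
    ∃ G : Finset C(Icc (0 : ℝ) T, X), G.Nonempty ∧ ∀ η ∈ K,
      (∫⁻ γ, Metric.infEDist γ G ^ p ∂η.toMeasure) ^ (1 / p) ≤ ε := by
  have hp0 : 0 < p := by linarith
  have hθ : min ε 1 ^ p / 3 ≠ 0 := by
    refine ENNReal.div_ne_zero.2 ⟨?_, by simp⟩
    exact (ENNReal.rpow_pos (pos_iff_ne_zero.2 (by simp [hε])) (by simp)).ne'
  set θ := min ε 1 ^ p / 3 with hθdef
  set c : ℝ≥0∞ := 2 ^ (p - 1) with hc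
  have hctop : c ≠ ∞ := by rw [hc]; finiteness
  have h2top : (2 : ℝ≥0∞) ^ p ≠ ∞ := by finiteness
  -- Each of the three error terms is to be at most `θ`. The order matters: `δ` fixes the net `I`,
  -- its cardinality fixes `τ`, and `τ` fixes `F`.
  obtain ⟨ε', hε', -, hε'θ⟩ := ENNReal.exists_mul_rpow_le (a := c * c) (by finiteness) hθ hp0
  obtain ⟨δ, hδ, hδtop, hδθ⟩ := ENNReal.exists_mul_rpow_le (a := c * c * 2 ^ p * A)
    (by finiteness) hθ (sub_pos.2 hp)
  obtain ⟨I, hI⟩ : ∃ I : Finset (Icc (0 : ℝ) T), ∀ t, ∃ s ∈ I, edist t s ≤ δ := by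
    obtain ⟨I, hIf, hI⟩ := EMetric.totallyBounded_iff.1
      (isCompact_univ (X := Icc (0 : ℝ) T)).totallyBounded δ (pos_iff_ne_zero.2 hδ)
    refine ⟨hIf.toFinset, fun t => ?_⟩
    obtain ⟨s, hs, hts⟩ := mem_iUnion₂.1 (hI (mem_univ t))
    exact ⟨s, by simpa using hs, le_of_lt hts⟩
  obtain ⟨τ, hτ, -, hτθ⟩ := ENNReal.exists_mul_rpow_le (a := c * 2 ^ p * I.card)
    (by finiteness) hθ hp0
  obtain ⟨F, hF, hFK⟩ := hM τ hτ
  obtain ⟨G, hG, hGle⟩ := exists_finset_infEDist_path_le hp hT hI hF hε'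
  refine ⟨G, hG, fun η hη => ?_⟩
  have hpt : ∀ γ : C(Icc (0 : ℝ) T, X), Metric.infEDist γ G ^ p
      ≤ c * 2 ^ p * (∑ i : I, Metric.infEDist (γ i) F ^ p)
        + (c * c * 2 ^ p * δ ^ (p - 1) * pAction p γ + c * c * ε' ^ p) := by
    intro γ
    set S := ⨆ i : I, Metric.infEDist (γ i) (F : Set X)
    set B := δ ^ (1 - 1 / p) * pAction p γ ^ (1 / p)
    -- A sum in place of the supremum lets each term be integrated against a single marginal.
    have hS : S ^ p ≤ ∑ i : I, Metric.infEDist (γ i) F ^ p := by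
      rw [← ENNReal.le_rpow_inv_iff hp0]
      refine iSup_le fun i => ?_
      rw [ENNReal.le_rpow_inv_iff hp0]
      exact Finset.single_le_sum (f := fun i : I => Metric.infEDist (γ i) (F : Set X) ^ p)
        (fun _ _ => zero_le) (Finset.mem_univ i)
    have hB : B ^ p = δ ^ (p - 1) * pAction p γ := by
      rw [ENNReal.mul_rpow_of_nonneg _ _ hp0.le, ← ENNReal.rpow_mul, ← ENNReal.rpow_mul,
        sub_mul, one_div, inv_mul_cancel₀ hp0.ne', one_mul, ENNReal.rpow_one]
    calc Metric.infEDist γ G ^ p ≤ (2 * S + (2 * B + ε')) ^ p := by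
          refine ENNReal.rpow_le_rpow ((hGle γ).trans_eq ?_) hp0.le
          ring
      _ ≤ c * ((2 * S) ^ p + c * ((2 * B) ^ p + ε' ^ p)) :=
          (ENNReal.rpow_add_le_mul_rpow_add_rpow _ _ hp.le).trans <| by
            gcongr
            exact ENNReal.rpow_add_le_mul_rpow_add_rpow _ _ hp.le
      _ = c * 2 ^ p * S ^ p + (c * c * 2 ^ p * δ ^ (p - 1) * pAction p γ + c * c * ε' ^ p) := by
          rw [ENNReal.mul_rpow_of_nonneg _ _ hp0.le, ENNReal.mul_rpow_of_nonneg _ _ hp0.le, hB]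
          ring
      _ ≤ _ := by gcongr
  have hmeas : ∀ i : I, Measurable fun γ : C(Icc (0 : ℝ) T, X) =>
      Metric.infEDist (γ i) (F : Set X) ^ p := fun i =>
    (Metric.continuous_infEDist.measurable.comp (measurable_evalPath _)).pow_const p
  have hmarg : ∀ i : I, ∫⁻ γ, Metric.infEDist (γ i) (F : Set X) ^ p ∂η.toMeasure ≤ τ ^ p := by
    intro i
    have h := hFK η hη i
    rw [one_div, ENNReal.rpow_inv_le_iff hp0] at h
    rwa [show (marginal η i).toMeasure = η.toMeasure.map fun γ => γ i from rfl,
      lintegral_map (Metric.continuous_infEDist.measurable.pow_const p)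
        (measurable_evalPath _)] at h
  rw [one_div, ENNReal.rpow_inv_le_iff hp0]
  calc ∫⁻ γ, Metric.infEDist γ G ^ p ∂η.toMeasure
      ≤ c * 2 ^ p * (∑ i : I, ∫⁻ γ, Metric.infEDist (γ i) (F : Set X) ^ p ∂η.toMeasure)
        + (c * c * 2 ^ p * δ ^ (p - 1) * ∫⁻ γ, pAction p γ ∂η.toMeasure + c * c * ε' ^ p) := by
        -- The splitting never needs measurability of the action: the other summands are measurable,
        -- and the factor taken out is finite.
        refine (lintegral_mono hpt).trans_eq ?_
        have hsum : Measurable fun γ : C(Icc (0 : ℝ) T, X) =>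
            ∑ i : I, Metric.infEDist (γ i) (F : Set X) ^ p :=
          Finset.measurable_fun_sum _ fun i _ => hmeas i
        have hδp : δ ^ (p - 1) ≠ ∞ := ENNReal.rpow_ne_top_of_nonneg (by linarith) hδtop
        rw [lintegral_add_left (hsum.const_mul _), lintegral_const_mul _ hsum,
          lintegral_finsetSum _ fun i _ => hmeas i, lintegral_add_right _ measurable_const,
          lintegral_const_mul' _ _ (by finiteness), lintegral_const, measure_univ, mul_one]
    _ ≤ c * 2 ^ p * (∑ _i : I, τ ^ p)
        + (c * c * 2 ^ p * δ ^ (p - 1) * A + c * c * ε' ^ p) := by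
        gcongr with i
        · exact hmarg i
        · exact hK η hη
    _ = c * 2 ^ p * I.card * τ ^ p + (c * c * 2 ^ p * A * δ ^ (p - 1) + c * c * ε' ^ p) := by
        rw [Finset.sum_const, Finset.card_univ, Fintype.card_coe, nsmul_eq_mul]
        ring
    _ ≤ θ + (θ + θ) := by gcongr
    _ = min ε 1 ^ p := by
        rw [hθdef, ← add_assoc]
        exact ENNReal.add_thirds _
    _ ≤ ε ^ p := ENNReal.rpow_le_rpow (min_le_left _ _) hp0.le

end Lifting

/-! ### Relative compactness of `K` -/

theorem propositionA4 {X : Type*} [MetricSpace X] [CompleteSpace X] [SecondCountableTopology X]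
    [MeasurableSpace X] [BorelSpace X] (p : ℝ) [Fact (1 ≤ p)] (hp : 1 < p) (T : ℝ) (hT : 0 < T)
    (K : Set (WassersteinSpace p C(Icc (0 : ℝ) T, X)))
    (hA : (⨆ η ∈ K, ∫⁻ γ, pAction p γ ∂η.toMeasure) < ∞)
    (hB : ∃ x₀ : X, (⨆ η ∈ K,
      ⨆ x ∈ (marginal η ⟨0, le_rfl, hT.le⟩).toMeasure.support, edist x x₀) < ∞)
    (hC : IsCompact (closure (marginalCurve '' K))) :
    IsCompact (closure K) := by
  obtain ⟨x₀, -⟩ := hB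
  have : Nonempty X := ⟨x₀⟩
  -- Evaluation is jointly continuous, so a compact set of curves times `[0,T]` has compact image;
  -- all marginals of all `η ∈ K` lie in it.
  have hM : TotallyBounded ((fun z : C(Icc (0 : ℝ) T, WassersteinSpace p X) × Icc (0 : ℝ) T =>
      z.1 z.2) '' (closure (marginalCurve '' K) ×ˢ univ)) :=
    ((hC.prod isCompact_univ).image continuous_eval).totallyBounded
  have hK : TotallyBounded K := totallyBounded_of_exists_finset_lintegral_infEDist_le fun ε hε =>
    exists_finset_lintegral_infEDist_path_le hp hT hA.ne
      (fun η hη => le_iSup₂ (f := fun η _ => ∫⁻ γ, pAction p γ ∂η.toMeasure) η hη)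
      (fun τ hτ => by
        obtain ⟨F, hF, hFM⟩ := hM.exists_finset_lintegral_infEDist_le hτ
        exact ⟨F, hF, fun η hη t => hFM (marginal η t)
          ⟨(marginalCurve η, t), ⟨subset_closure ⟨η, hη, rfl⟩, mem_univ t⟩, rfl⟩⟩) hε
  exact hK.closure.isCompact_of_isClosed isClosed_closure
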